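/- Let $\omega=e^{2\pi\sqrt{-1}/3}$, let $|0\rangle,|1\rangle,|2\rangle,|3\rangle$ be the standard basis of $\mathbb{C}^4$, and for $t=0,1,2$ put $$|\alpha_t\rangle=|0\rangle+\omega^{t}|1\rangle+(\omega^{t})^{2}|2\rangle,\qquad |\beta_t\rangle=|1\rangle+\omega^{t}|2\rangle+(\omega^{t})^{2}|3\rangle .$$ Then the twelve (unnormalized) vectors in $\mathbb{C}^4\otimes\mathbb{C}^4$ $$|\phi_{t+1}\rangle=|0\rangle_A|\alpha_t\rangle_B,\quad |\phi_{t+4}\rangle=|\alpha_t\rangle_A|3\rangle_B,\quad |\phi_{t+7}\rangle=|3\rangle_A|\beta_t\rangle_B,\quad |\phi_{t+10}\rangle=|\beta_t\rangle_A|0\rangle_B\qquad(t=0,1,2)$$ form a nonlocal set of orthogonal product states: they are nonzero, pairwise orthogonal product vectors, and they cannot be perfectly distinguished by local operations and classical communication (LOCC). That is, no protocol in which Alice (holding the first factor) and Bob (holding the second) in turn (in any order) apply quantum instruments with finitely many outcomes to their own systems, each choice depending on all previously communicated outcomes, identifies every one of the twelve states with probability one; the number of rounds may be finite or infinite, the success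 probability of an infinite protocol being the limit of the success probabilities of its finite stages (each stage extending the previous one and ending with a guess). -/

import Mathlib

open scoped Kronecker Topology

noncomputable section

/-- `H a b` is the Hilbert space `ℂᵃ ⊗ ℂᵇ`, in the coordinates given by the product basis
`|i⟩_A |j⟩_B`. State vectors need not be normalized. -/
abbrev H (a b : ℕ) : Type := EuclideanSpace ℂ (Fin a × Fin b)

/-- The product vector `|u⟩_A |v⟩_B`. -/
def prodState {a b : ℕ} (u : EuclideanSpace ℂ (Fin a)) (v : EuclideanSpace ℂ (Fin b)) : H a b :=
  WithLp.toLp 2 fun p => u p.1 * v p.2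

/-- `M ⊗ 1`, applied to a bipartite state vector. -/
def applyA {a a' b : ℕ} (M : Matrix (Fin a') (Fin a) ℂ) (ψ : H a b) : H a' b :=
  WithLp.toLp 2 ((M ⊗ₖ (1 : Matrix (Fin b) (Fin b) ℂ)).mulVec ψ.ofLp)

/-- `1 ⊗ M`, applied to a bipartite state vector. -/
def applyB {a b b' : ℕ} (M : Matrix (Fin b') (Fin b) ℂ) (ψ : H a b) : H a b' :=
  WithLp.toLp 2 (((1 : Matrix (Fin a) (Fin a) ℂ) ⊗ₖ M).mulVec ψ.ofLp)

/-- A quantum instrument on `ℂᵃ` with finitely many classical outcomes: outcome `k` is the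
completely positive map `ρ ↦ ∑ s, K ρ Kᴴ` with Kraus operators `K = kraus k s` from `ℂᵃ` to
`ℂ^(outDim k)`, and the sum of these maps over all outcomes is trace preserving. A measurement
`{M_k}` is the case of one Kraus operator per outcome; ancillas, discarded subsystems,
unitaries and local randomness are covered as well. -/
structure LocalInstrument (a : ℕ) where
  numOut : ℕ
  outDim : Fin numOut → ℕ
  numKraus : Fin numOut → ℕ
  kraus : (k : Fin numOut) → Fin (numKraus k) → Matrix (Fin (outDim k)) (Fin a) ℂ
  complete : ∑ k, ∑ s, (kraus k s).conjTranspose * kraus k s = 1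

/-- LOCC protocols with finitely many rounds on `ℂᵃ ⊗ ℂᵇ`, whose final classical result is a guess
in `ι`. In each round one party applies a local instrument and communicates the outcome; who acts
next and with which instrument may depend on all outcomes so far. -/
inductive Protocol (ι : Type) : ℕ → ℕ → Type
  | guess {a b : ℕ} (i : ι) : Protocol ι a b
  | alice {a b : ℕ} (I : LocalInstrument a)
      (next : (k : Fin I.numOut) → Protocol ι (I.outDim k) b) : Protocol ι a b
  | bob {a b : ℕ} (I : LocalInstrument b)
      (next : (k : Fin I.numOut) → Protocol ι a (I.outDim k)) : Protocol ι a b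

/-- Born rule: `P.weight i ψ` is `⟨ψ|ψ⟩` times the probability that `P`, run on the (normalized)
state `ψ`, ends with the guess `i`. -/
def Protocol.weight {ι : Type} [DecidableEq ι] (i : ι) :
    {a b : ℕ} → Protocol ι a b → H a b → ℝ
  | _, _, .guess j, ψ => if j = i then ‖ψ‖ ^ 2 else 0
  | _, _, .alice I next, ψ => ∑ k, ∑ s, (next k).weight i (applyA (I.kraus k s) ψ)
  | _, _, .bob I next, ψ => ∑ k, ∑ s, (next k).weight i (applyB (I.kraus k s) ψ)

/-- The probability that `P`, run on the state `ψ / ‖ψ‖`, ends with the guess `i`. -/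
def Protocol.prob {ι : Type} [DecidableEq ι] {a b : ℕ} (P : Protocol ι a b) (i : ι)
    (ψ : H a b) : ℝ :=
  P.weight i ψ / ‖ψ‖ ^ 2

/-- `Extends P Q`: the protocol `Q` first does exactly what `P` does, but instead of making its
final guess it may continue with further rounds (or revise the guess). -/
inductive Protocol.Extends {ι : Type} : {a b : ℕ} → Protocol ι a b → Protocol ι a b → Prop
  | guess {a b : ℕ} (i : ι) (Q : Protocol ι a b) : Extends (.guess i) Q
  | alice {a b : ℕ} (I : LocalInstrument a)
      (next next' : (k : Fin I.numOut) → Protocol ι (I.outDim k) b)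
      (h : ∀ k, Extends (next k) (next' k)) : Extends (.alice I next) (.alice I next')
  | bob {a b : ℕ} (I : LocalInstrument b)
      (next next' : (k : Fin I.numOut) → Protocol ι a (I.outDim k))
      (h : ∀ k, Extends (next k) (next' k)) : Extends (.bob I next) (.bob I next')

/-- The states `ψ i` can be perfectly distinguished by LOCC: there is an LOCC protocol, with
finitely or infinitely many rounds, that identifies each of them with probability one. A protocol
with infinitely many rounds is the sequence of its finite stages, each of which extends the
previous one, and its success probability is the limit over the stages. A protocol with finitely
many rounds is a constant sequence. -/
def LOCCDistinguishable {ι : Type} [DecidableEq ι] {a b : ℕ} (ψ : ι → H a b) : Prop :=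
  ∃ P : ℕ → Protocol ι a b, (∀ n, (P n).Extends (P (n + 1))) ∧
    ∀ i, Filter.Tendsto (fun n => (P n).prob i (ψ i)) Filter.atTop (𝓝 1)

/-- A set of orthogonal product states: nonzero product vectors, pairwise orthogonal. -/
def IsOPS {ι : Type} {a b : ℕ} (ψ : ι → H a b) : Prop :=
  (∀ i, ψ i ≠ 0 ∧ ∃ u v, ψ i = prodState u v) ∧ Pairwise fun i j => inner ℂ (ψ i) (ψ j) = 0

/-- `ω = e^{2πi/3}`. -/
def ω : ℂ := Complex.exp (2 * Real.pi * Complex.I / 3)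

/-- The computational basis vector `|j⟩` of `ℂ⁴`. -/
def ket (j : Fin 4) : EuclideanSpace ℂ (Fin 4) := EuclideanSpace.single j 1

/-- `|0⟩ + ωᵗ|1⟩ + (ωᵗ)²|2⟩`. -/
def lowKet (t : ℕ) : EuclideanSpace ℂ (Fin 4) := ket 0 + ω ^ t • ket 1 + (ω ^ t) ^ 2 • ket 2

/-- `|1⟩ + ωᵗ|2⟩ + (ωᵗ)²|3⟩`. -/
def highKet (t : ℕ) : EuclideanSpace ℂ (Fin 4) := ket 1 + ω ^ t • ket 2 + (ω ^ t) ^ 2 • ket 3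

/-- The twelve product states in `ℂ⁴ ⊗ ℂ⁴`. -/
def phi : Fin 12 → H 4 4 :=
  ![prodState (ket 0) (lowKet 0), prodState (ket 0) (lowKet 1), prodState (ket 0) (lowKet 2),
    prodState (lowKet 0) (ket 3), prodState (lowKet 1) (ket 3), prodState (lowKet 2) (ket 3),
    prodState (ket 3) (highKet 0), prodState (ket 3) (highKet 1), prodState (ket 3) (highKet 2),
    prodState (highKet 0) (ket 0), prodState (highKet 1) (ket 0), prodState (highKet 2) (ket 0)]

end

noncomputable section

open Matrix Filter
open scoped ComplexOrder

/-! The twelve states are so rigid that no useful local step preserves their orthogonality. In a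
protocol that succeeds in the limit, every branch must still be able to succeed, and perfect success
in the limit forces the branch states to be orthogonal (`PerfectLimit.inner_eq_zero`). Suppose
Alice's accumulated operator is `A` while Bob's is a nonzero scaled isometry. Orthogonality within
the `α` and `β` triples makes two overlapping 3×3 blocks of `Aᴴ * A` circulant, and one further
orthogonality relation kills the off-diagonal entries; so `A` is a scaled isometry too, and
symmetrically for Bob.

By induction every branch of every finite stage acts as a scaled isometry, so the probability of a
given guess is the same for all twelve states (`Protocol.weight_eq_of_perfectLimit`). The success
probabilities at each stage then sum to 1, whereas in the limit they would have to sum to 12. -/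

/-! ### Local operators on bipartite vectors. -/

/-- `A ⊗ B`, applied to a bipartite state vector. -/
def applyAB {a a' b b' : ℕ} (A : Matrix (Fin a') (Fin a) ℂ) (B : Matrix (Fin b') (Fin b) ℂ)
    (ψ : H a b) : H a' b' :=
  WithLp.toLp 2 ((A ⊗ₖ B).mulVec ψ.ofLp)

theorem applyA_eq_applyAB {a a' b : ℕ} (M : Matrix (Fin a') (Fin a) ℂ) (ψ : H a b) :
    applyA M ψ = applyAB M 1 ψ := rfl

theorem applyB_eq_applyAB {a b b' : ℕ} (M : Matrix (Fin b') (Fin b) ℂ) (ψ : H a b) :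
    applyB M ψ = applyAB 1 M ψ := rfl

theorem applyAB_add {a a' b b' : ℕ} (A : Matrix (Fin a') (Fin a) ℂ)
    (B : Matrix (Fin b') (Fin b) ℂ) (x y : H a b) :
    applyAB A B (x + y) = applyAB A B x + applyAB A B y := by
  simp [applyAB, Matrix.mulVec_add]

theorem applyAB_one_one {a b : ℕ} (ψ : H a b) : applyAB 1 1 ψ = ψ := by
  simp [applyAB]

theorem applyAB_zero_left {a a' b b' : ℕ} (B : Matrix (Fin b') (Fin b) ℂ) (ψ : H a b) :
    applyAB (0 : Matrix (Fin a') (Fin a) ℂ) B ψ = 0 := by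
  simp [applyAB]

theorem applyAB_zero_right {a a' b b' : ℕ} (A : Matrix (Fin a') (Fin a) ℂ) (ψ : H a b) :
    applyAB A (0 : Matrix (Fin b') (Fin b) ℂ) ψ = 0 := by
  simp [applyAB]

theorem applyA_applyAB {a a' a'' b b' : ℕ} (M : Matrix (Fin a'') (Fin a') ℂ)
    (A : Matrix (Fin a') (Fin a) ℂ) (B : Matrix (Fin b') (Fin b) ℂ) (ψ : H a b) :
    applyA M (applyAB A B ψ) = applyAB (M * A) B ψ := by
  simp [applyA, applyAB, ← Matrix.mul_kronecker_mul]

theorem applyB_applyAB {a a' b b' b'' : ℕ} (M : Matrix (Fin b'') (Fin b') ℂ)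
    (A : Matrix (Fin a') (Fin a) ℂ) (B : Matrix (Fin b') (Fin b) ℂ) (ψ : H a b) :
    applyB M (applyAB A B ψ) = applyAB A (M * B) ψ := by
  simp [applyB, applyAB, ← Matrix.mul_kronecker_mul]

theorem inner_applyAB {a a' b b' : ℕ} (A : Matrix (Fin a') (Fin a) ℂ)
    (B : Matrix (Fin b') (Fin b) ℂ) (x y : H a b) :
    inner ℂ (applyAB A B x) (applyAB A B y) =
      star x.ofLp ⬝ᵥ (((Aᴴ * A) ⊗ₖ (Bᴴ * B)) *ᵥ y.ofLp) := by
  rw [EuclideanSpace.inner_eq_star_dotProduct, dotProduct_comm]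
  simp only [applyAB, star_mulVec, Matrix.conjTranspose_kronecker, Matrix.mul_kronecker_mul]
  rw [← Matrix.mulVec_mulVec, Matrix.dotProduct_mulVec, Matrix.dotProduct_mulVec,
    Matrix.dotProduct_mulVec]

theorem inner_applyAB_prodState {a a' b b' : ℕ} (A : Matrix (Fin a') (Fin a) ℂ)
    (B : Matrix (Fin b') (Fin b) ℂ) (u u' : EuclideanSpace ℂ (Fin a))
    (v v' : EuclideanSpace ℂ (Fin b)) :
    inner ℂ (applyAB A B (prodState u v)) (applyAB A B (prodState u' v')) =
      (star u.ofLp ⬝ᵥ ((Aᴴ * A) *ᵥ u'.ofLp)) * (star v.ofLp ⬝ᵥ ((Bᴴ * B) *ᵥ v'.ofLp)) := by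
  rw [inner_applyAB]
  simp only [prodState, dotProduct, mulVec, Fintype.sum_prod_type, Finset.sum_mul_sum,
    Matrix.kroneckerMap_apply, Pi.star_apply, star_mul']
  refine Finset.sum_congr rfl fun i _ => Finset.sum_congr rfl fun j _ => ?_
  rw [mul_mul_mul_comm, Finset.sum_mul_sum]
  congr 1
  exact Finset.sum_congr rfl fun k _ => Finset.sum_congr rfl fun l _ => by ring

theorem inner_prodState {a b : ℕ} (u u' : EuclideanSpace ℂ (Fin a))
    (v v' : EuclideanSpace ℂ (Fin b)) :
    inner ℂ (prodState u v) (prodState u' v') =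
      (star u.ofLp ⬝ᵥ u'.ofLp) * (star v.ofLp ⬝ᵥ v'.ofLp) := by
  have h := inner_applyAB_prodState (1 : Matrix (Fin a) (Fin a) ℂ)
    (1 : Matrix (Fin b) (Fin b) ℂ) u u' v v'
  simpa only [applyAB_one_one, conjTranspose_one, mul_one, one_mulVec] using h

theorem norm_sq_applyAB_eq {a a' b b' : ℕ} (A : Matrix (Fin a') (Fin a) ℂ)
    (B : Matrix (Fin b') (Fin b) ℂ) (x : H a b) :
    ‖applyAB A B x‖ ^ 2 = (star x.ofLp ⬝ᵥ (((Aᴴ * A) ⊗ₖ (Bᴴ * B)) *ᵥ x.ofLp)).re := by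
  rw [← inner_applyAB]
  exact (inner_self_eq_norm_sq (𝕜 := ℂ) _).symm

theorem sum_norm_sq_applyA {a b : ℕ} (I : LocalInstrument a) (ψ : H a b) :
    ∑ k, ∑ s, ‖applyA (I.kraus k s) ψ‖ ^ 2 = ‖ψ‖ ^ 2 := by
  -- The squared norm of a branch is additive in `Kᴴ * K`, so the completeness relation can be
  -- summed inside `f`.
  let f : Matrix (Fin a) (Fin a) ℂ →+ ℝ :=
    { toFun := fun E => (star ψ.ofLp ⬝ᵥ ((E ⊗ₖ (1 : Matrix (Fin b) (Fin b) ℂ)) *ᵥ ψ.ofLp)).re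
      map_zero' := by simp
      map_add' := fun E F => by
        simp [Matrix.add_kronecker, Matrix.add_mulVec, dotProduct_add] }
  have h : ∀ {a'} (M : Matrix (Fin a') (Fin a) ℂ), ‖applyA M ψ‖ ^ 2 = f (Mᴴ * M) := fun M => by
    rw [applyA_eq_applyAB, norm_sq_applyAB_eq]; simp [f]
  simp only [h, ← map_sum, I.complete]
  rw [← applyAB_one_one ψ, norm_sq_applyAB_eq]; simp [f]

theorem sum_norm_sq_applyB {a b : ℕ} (I : LocalInstrument b) (ψ : H a b) :
    ∑ k, ∑ s, ‖applyB (I.kraus k s) ψ‖ ^ 2 = ‖ψ‖ ^ 2 := by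
  let f : Matrix (Fin b) (Fin b) ℂ →+ ℝ :=
    { toFun := fun E => (star ψ.ofLp ⬝ᵥ (((1 : Matrix (Fin a) (Fin a) ℂ) ⊗ₖ E) *ᵥ ψ.ofLp)).re
      map_zero' := by simp
      map_add' := fun E F => by
        simp [Matrix.kronecker_add, Matrix.add_mulVec, dotProduct_add] }
  have h : ∀ {b'} (M : Matrix (Fin b') (Fin b) ℂ), ‖applyB M ψ‖ ^ 2 = f (Mᴴ * M) := fun M => by
    rw [applyB_eq_applyAB, norm_sq_applyAB_eq]; simp [f]
  simp only [h, ← map_sum, I.complete]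
  rw [← applyAB_one_one ψ, norm_sq_applyAB_eq]; simp [f]

/-! ### Outcome weights as quadratic functions of the state. -/

namespace Protocol

variable {ι : Type} [DecidableEq ι]

theorem weight_nonneg (i : ι) {a b : ℕ} (P : Protocol ι a b) (ψ : H a b) :
    0 ≤ P.weight i ψ := by
  induction P with
  | guess j => simp only [weight]; split_ifs <;> positivity
  | alice I next ih =>
    exact Finset.sum_nonneg fun k _ => Finset.sum_nonneg fun s _ => ih k _
  | bob I next ih =>
    exact Finset.sum_nonneg fun k _ => Finset.sum_nonneg fun s _ => ih k _

theorem sum_weight [Fintype ι] {a b : ℕ} (P : Protocol ι a b) (ψ : H a b) :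
    ∑ i, P.weight i ψ = ‖ψ‖ ^ 2 := by
  induction P with
  | guess j => simp [weight]
  | alice I next ih =>
    simp only [weight]
    rw [Finset.sum_comm, ← sum_norm_sq_applyA I]
    refine Finset.sum_congr rfl fun k _ => ?_
    rw [Finset.sum_comm]
    exact Finset.sum_congr rfl fun s _ => ih k _
  | bob I next ih =>
    simp only [weight]
    rw [Finset.sum_comm, ← sum_norm_sq_applyB I]
    refine Finset.sum_congr rfl fun k _ => ?_
    rw [Finset.sum_comm]
    exact Finset.sum_congr rfl fun s _ => ih k _

theorem weight_le [Fintype ι] (i : ι) {a b : ℕ} (P : Protocol ι a b) (ψ : H a b) :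
    P.weight i ψ ≤ ‖ψ‖ ^ 2 := by
  rw [← P.sum_weight ψ]
  exact Finset.single_le_sum (fun j _ => weight_nonneg j P ψ) (Finset.mem_univ i)

theorem weight_zero [Fintype ι] (i : ι) {a b : ℕ} (P : Protocol ι a b) :
    P.weight i (0 : H a b) = 0 :=
  le_antisymm (by simpa using P.weight_le i 0) (P.weight_nonneg i 0)

/-- Young's inequality at each leaf, carried through the linear branch maps. It replaces a
Cauchy–Schwarz estimate for the outcome operators, which then need not be introduced. -/
theorem weight_add_le (i : ι) {t : ℝ} (ht : 0 < t) {a b : ℕ} (P : Protocol ι a b) (x y : H a b) :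
    P.weight i (x + y) ≤ (1 + t) * P.weight i x + (1 + t⁻¹) * P.weight i y := by
  induction P with
  | guess j =>
    simp only [weight]
    split_ifs
    · have h : ‖x + y‖ ^ 2 ≤ (‖x‖ + ‖y‖) ^ 2 := by gcongr; exact norm_add_le x y
      have h2 : 0 ≤ t⁻¹ * (t * ‖x‖ - ‖y‖) ^ 2 := by positivity
      have h3 : t⁻¹ * (t * ‖x‖ - ‖y‖) ^ 2 = t * ‖x‖ ^ 2 - 2 * ‖x‖ * ‖y‖ + t⁻¹ * ‖y‖ ^ 2 := by
        field_simp
        ring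
      linarith
    · simp
  | alice I next ih =>
    simp only [weight, Finset.mul_sum, ← Finset.sum_add_distrib]
    refine Finset.sum_le_sum fun k _ => Finset.sum_le_sum fun s _ => ?_
    rw [applyA_eq_applyAB, applyAB_add]
    exact ih k _ _
  | bob I next ih =>
    simp only [weight, Finset.mul_sum, ← Finset.sum_add_distrib]
    refine Finset.sum_le_sum fun k _ => Finset.sum_le_sum fun s _ => ?_
    rw [applyB_eq_applyAB, applyAB_add]
    exact ih k _ _

theorem weight_smul (i : ι) (c : ℂ) {a b : ℕ} (P : Protocol ι a b) (x : H a b) :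
    P.weight i (c • x) = ‖c‖ ^ 2 * P.weight i x := by
  induction P with
  | guess j => simp [weight, norm_smul, mul_pow]
  | alice I next ih =>
    simp only [weight, Finset.mul_sum, ← ih]
    simp [applyA, Matrix.mulVec_smul]
  | bob I next ih =>
    simp only [weight, Finset.mul_sum, ← ih]
    simp [applyB, Matrix.mulVec_smul]

end Protocol

/-! ### Perfect discrimination in the limit. -/

/-- The success weights of the stages `P n` on the states `ψ i` tend to their largest possible
values. -/
def PerfectLimit {ι : Type} [DecidableEq ι] {a b : ℕ} (P : ℕ → Protocol ι a b)
    (ψ : ι → H a b) : Prop :=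
  ∀ i, Tendsto (fun n => (P n).weight i (ψ i)) atTop (𝓝 (‖ψ i‖ ^ 2))

theorem PerfectLimit.tendsto_zero {ι : Type} [DecidableEq ι] [Fintype ι] {a b : ℕ}
    {P : ℕ → Protocol ι a b} {ψ : ι → H a b} (h : PerfectLimit P ψ) {i j : ι} (hij : i ≠ j) :
    Tendsto (fun n => (P n).weight i (ψ j)) atTop (𝓝 0) := by
  have h1 : Tendsto (fun n => ‖ψ j‖ ^ 2 - (P n).weight j (ψ j)) atTop (𝓝 0) := by
    have := (h j).const_sub (‖ψ j‖ ^ 2)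
    rwa [sub_self] at this
  refine squeeze_zero (fun n => Protocol.weight_nonneg _ _ _) (fun n => ?_) h1
  rw [← (P n).sum_weight (ψ j)]
  have := Finset.sum_le_univ_sum_of_nonneg (s := {i, j})
    (fun k => Protocol.weight_nonneg k (P n) (ψ j))
  rw [Finset.sum_pair hij] at this
  linarith

theorem PerfectLimit.tendsto_weight {ι : Type} [DecidableEq ι] [Fintype ι] {a b : ℕ}
    {P : ℕ → Protocol ι a b} {ψ : ι → H a b} (h : PerfectLimit P ψ) (i j : ι) :
    Tendsto (fun n => (P n).weight i (ψ j)) atTop (𝓝 (if i = j then ‖ψ j‖ ^ 2 else 0)) := by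
  split_ifs with hij
  · subst hij; exact h i
  · exact h.tendsto_zero hij

theorem inner_eq_zero_of_norm_sq_add_smul_le {E : Type*} [NormedAddCommGroup E]
    [InnerProductSpace ℂ E] {x y : E}
    (h : ∀ c : ℂ, ‖x + c • y‖ ^ 2 ≤ ‖x‖ ^ 2 + ‖c • y‖ ^ 2) : inner ℂ x y = 0 := by
  -- This `c` turns the cross term into `2 * ‖⟪x, y⟫‖ ^ 2`.
  have key := h (starRingEnd ℂ (inner ℂ x y))
  rw [norm_add_sq (𝕜 := ℂ), inner_smul_right, Complex.conj_mul'] at key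
  have : (RCLike.re ((‖(inner ℂ x y : ℂ)‖ : ℂ) ^ 2) : ℝ) = ‖(inner ℂ x y : ℂ)‖ ^ 2 := by
    norm_cast
  rw [this] at key
  exact norm_eq_zero.1 (pow_eq_zero_iff two_ne_zero |>.1
    (le_antisymm (by linarith) (sq_nonneg _)))

/-- Perfect discrimination in the limit is only possible for orthogonal states. -/
theorem PerfectLimit.inner_eq_zero {ι : Type} [DecidableEq ι] [Fintype ι] {a b : ℕ}
    {P : ℕ → Protocol ι a b} {ψ : ι → H a b} (h : PerfectLimit P ψ) {i j : ι} (hij : i ≠ j) :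
    inner ℂ (ψ i) (ψ j) = 0 := by
  refine inner_eq_zero_of_norm_sq_add_smul_le fun c => ?_
  have bound : ∀ t : ℝ, 0 < t →
      ‖ψ i + c • ψ j‖ ^ 2 ≤ (1 + t) * (‖ψ i‖ ^ 2 + ‖c • ψ j‖ ^ 2) := fun t ht => by
    -- In the limit only `ψ i` has weight at guess `i` and only `ψ j` at guess `j`. With `t` at `i`
    -- and `t⁻¹` elsewhere, both surviving terms get the factor `1 + t`.
    let r : ι → ℝ := fun k => if k = i then t else t⁻¹
    have hr : ∀ k, 0 < r k := fun k => by simp only [r]; split_ifs <;> positivity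
    have hlim : Tendsto (fun n => ∑ k, ((1 + r k) * (P n).weight k (ψ i) +
        (1 + (r k)⁻¹) * (‖c‖ ^ 2 * (P n).weight k (ψ j)))) atTop
        (𝓝 (∑ k, ((1 + r k) * (if k = i then ‖ψ i‖ ^ 2 else 0) +
        (1 + (r k)⁻¹) * (‖c‖ ^ 2 * (if k = j then ‖ψ j‖ ^ 2 else 0))))) :=
      tendsto_finsetSum _ fun k _ => ((h.tendsto_weight k i).const_mul _).add
        (((h.tendsto_weight k j).const_mul _).const_mul _)
    have hle := ge_of_tendsto' hlim (b := ‖ψ i + c • ψ j‖ ^ 2) fun n => by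
      rw [← (P n).sum_weight]
      refine Finset.sum_le_sum fun k _ => ?_
      rw [← Protocol.weight_smul]
      exact Protocol.weight_add_le k (hr k) _ _ _
    refine hle.trans_eq ?_
    rw [Finset.sum_add_distrib]
    simp [r, hij.symm, norm_smul]
    ring
  refine le_of_forall_pos_le_add fun ε hε => ?_
  set S := ‖ψ i‖ ^ 2 + ‖c • ψ j‖ ^ 2 with hS
  have hS0 : 0 ≤ S := by positivity
  refine (bound (ε / (S + 1)) (by positivity)).trans ?_
  have : ε / (S + 1) * S ≤ ε := by
    rw [div_mul_eq_mul_div, div_le_iff₀ (by positivity)]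
    nlinarith
  linarith

/-- Each deficit `g k - f n k` is nonnegative and bounded by the total deficit, which tends to zero.
-/
theorem tendsto_of_sum_tendsto_of_le {κ : Type*} [Fintype κ] {f : ℕ → κ → ℝ} {g : κ → ℝ}
    (hle : ∀ n k, f n k ≤ g k) (h : Tendsto (fun n => ∑ k, f n k) atTop (𝓝 (∑ k, g k)))
    (k : κ) : Tendsto (fun n => f n k) atTop (𝓝 (g k)) := by
  have h1 : Tendsto (fun n => g k - (∑ k, g k - ∑ k, f n k)) atTop (𝓝 (g k)) := by
    simpa using (h.const_sub (∑ k, g k)).const_sub (g k)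
  refine tendsto_of_tendsto_of_tendsto_of_le_of_le h1 tendsto_const_nhds (fun n => ?_)
    (fun n => hle n k)
  have := Finset.single_le_sum (f := fun k => g k - f n k) (fun k _ => sub_nonneg.2 (hle n k))
    (Finset.mem_univ k)
  rw [Finset.sum_sub_distrib] at this
  simp only at this ⊢
  linarith

/-- The branch norms add up to the full norm, so no branch may fall short. This holds for each
single Kraus operator, even though `s` is not communicated. -/
theorem PerfectLimit.of_alice {ι : Type} [DecidableEq ι] [Fintype ι] {a b : ℕ}
    {I : LocalInstrument a} {next : ℕ → (k : Fin I.numOut) → Protocol ι (I.outDim k) b}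
    {ψ : ι → H a b} (h : PerfectLimit (fun n => .alice I (next n)) ψ) (k : Fin I.numOut)
    (s : Fin (I.numKraus k)) :
    PerfectLimit (fun n => next n k) (fun i => applyA (I.kraus k s) (ψ i)) := by
  intro i
  have hi := h i
  simp only [Protocol.weight] at hi
  rw [← sum_norm_sq_applyA I] at hi
  simp only [← Fintype.sum_sigma'] at hi
  exact tendsto_of_sum_tendsto_of_le (fun n p => (next n p.1).weight_le i _) hi ⟨k, s⟩

theorem PerfectLimit.of_bob {ι : Type} [DecidableEq ι] [Fintype ι] {a b : ℕ}
    {I : LocalInstrument b} {next : ℕ → (k : Fin I.numOut) → Protocol ι a (I.outDim k)}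
    {ψ : ι → H a b} (h : PerfectLimit (fun n => .bob I (next n)) ψ) (k : Fin I.numOut)
    (s : Fin (I.numKraus k)) :
    PerfectLimit (fun n => next n k) (fun i => applyB (I.kraus k s) (ψ i)) := by
  intro i
  have hi := h i
  simp only [Protocol.weight] at hi
  rw [← sum_norm_sq_applyB I] at hi
  simp only [← Fintype.sum_sigma'] at hi
  exact tendsto_of_sum_tendsto_of_le (fun n p => (next n p.1).weight_le i _) hi ⟨k, s⟩

/-! ### Rigidity of matrices that preserve orthogonality. -/

theorem omega_sq : ω ^ 2 = -1 - ω := by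
  have h : IsPrimitiveRoot ω 3 := by
    simpa [ω] using Complex.isPrimitiveRoot_exp 3 (by norm_num)
  have := h.geom_sum_eq_zero (by norm_num)
  simp [Finset.sum_range_succ] at this
  linear_combination this

theorem conj_omega : starRingEnd ℂ ω = -1 - ω := by
  have h : IsPrimitiveRoot ω 3 := by
    simpa [ω] using Complex.isPrimitiveRoot_exp 3 (by norm_num)
  have h1 : ‖ω‖ = 1 := h.norm'_eq_one (by norm_num)
  have h2 : starRingEnd ℂ ω * ω = 1 := by
    simpa [h1] using Complex.conj_mul' ω
  have h3 := h.pow_eq_one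
  have h4 : starRingEnd ℂ ω = ω ^ 2 := by linear_combination ω ^ 2 * h2 - starRingEnd ℂ ω * h3
  rw [h4, omega_sq]

theorem ket_ofLp (j : Fin 4) : (ket j).ofLp = Pi.single j 1 := by
  simp [ket]

theorem lowKet_ofLp (t : ℕ) : (lowKet t).ofLp = ![1, ω ^ t, (ω ^ t) ^ 2, 0] := by
  ext j
  fin_cases j <;> simp [lowKet, ket]

theorem highKet_ofLp (t : ℕ) : (highKet t).ofLp = ![0, 1, ω ^ t, (ω ^ t) ^ 2] := by
  ext j
  fin_cases j <;> simp [highKet, ket]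

theorem lowKet_zero : (lowKet 0).ofLp = ![1, 1, 1, 0] := by simp [lowKet_ofLp]

theorem lowKet_one : (lowKet 1).ofLp = ![1, ω, -1 - ω, 0] := by simp [lowKet_ofLp, omega_sq]

theorem lowKet_two : (lowKet 2).ofLp = ![1, -1 - ω, ω, 0] := by
  have : (-1 - ω) ^ 2 = ω := by linear_combination omega_sq
  simp [lowKet_ofLp, omega_sq, this]

theorem highKet_zero : (highKet 0).ofLp = ![0, 1, 1, 1] := by simp [highKet_ofLp]

theorem highKet_one : (highKet 1).ofLp = ![0, 1, ω, -1 - ω] := by simp [highKet_ofLp, omega_sq]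

theorem highKet_two : (highKet 2).ofLp = ![0, 1, -1 - ω, ω] := by
  have : (-1 - ω) ^ 2 = ω := by linear_combination omega_sq
  simp [highKet_ofLp, omega_sq, this]

/-- The sesquilinear form of a matrix. -/
abbrev sform (E : Matrix (Fin 4) (Fin 4) ℂ) (u v : EuclideanSpace ℂ (Fin 4)) : ℂ :=
  star u.ofLp ⬝ᵥ (E *ᵥ v.ofLp)

/-- The `lowKet` vectors are the Fourier basis of the span of `ket 0`, `ket 1`, `ket 2`, and a
matrix diagonal in the Fourier basis is circulant. -/
theorem circulant_of_sform_lowKet {E : Matrix (Fin 4) (Fin 4) ℂ}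
    (h : ∀ t < 3, ∀ s < 3, t ≠ s → sform E (lowKet t) (lowKet s) = 0) :
    (E 0 0 = E 1 1 ∧ E 1 1 = E 2 2) ∧ (E 0 1 = E 1 2 ∧ E 1 2 = E 2 0) ∧
      (E 0 2 = E 1 0 ∧ E 1 0 = E 2 1) := by
  have h01 := h 0 (by norm_num) 1 (by norm_num) (by norm_num)
  have h02 := h 0 (by norm_num) 2 (by norm_num) (by norm_num)
  have h10 := h 1 (by norm_num) 0 (by norm_num) (by norm_num)
  have h12 := h 1 (by norm_num) 2 (by norm_num) (by norm_num)
  have h20 := h 2 (by norm_num) 0 (by norm_num) (by norm_num)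
  have h21 := h 2 (by norm_num) 1 (by norm_num) (by norm_num)
  simp [sform, lowKet_zero, lowKet_one, lowKet_two, dotProduct, mulVec, Fin.sum_univ_four,
    conj_omega] at h01 h02 h10 h12 h20 h21
  have hω := omega_sq
  clear h
  -- Conjugates are already eliminated; only linear algebra with `w ^ 2 = -1 - w` remains.
  generalize ω = w at *
  refine ⟨⟨?_, ?_⟩, ⟨?_, ?_⟩, ?_, ?_⟩ <;> grind

theorem circulant_of_sform_highKet {E : Matrix (Fin 4) (Fin 4) ℂ}
    (h : ∀ t < 3, ∀ s < 3, t ≠ s → sform E (highKet t) (highKet s) = 0) :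
    (E 1 1 = E 2 2 ∧ E 2 2 = E 3 3) ∧ (E 1 2 = E 2 3 ∧ E 2 3 = E 3 1) ∧
      (E 1 3 = E 2 1 ∧ E 2 1 = E 3 2) := by
  have h01 := h 0 (by norm_num) 1 (by norm_num) (by norm_num)
  have h02 := h 0 (by norm_num) 2 (by norm_num) (by norm_num)
  have h10 := h 1 (by norm_num) 0 (by norm_num) (by norm_num)
  have h12 := h 1 (by norm_num) 2 (by norm_num) (by norm_num)
  have h20 := h 2 (by norm_num) 0 (by norm_num) (by norm_num)
  have h21 := h 2 (by norm_num) 1 (by norm_num) (by norm_num)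
  simp [sform, highKet_zero, highKet_one, highKet_two, dotProduct, mulVec, Fin.sum_univ_four,
    conj_omega] at h01 h02 h10 h12 h20 h21
  have hω := omega_sq
  clear h
  generalize ω = w at *
  refine ⟨⟨?_, ?_⟩, ⟨?_, ?_⟩, ?_, ?_⟩ <;> grind

/-- The three `highKet` vectors span the same space as `ket 1`, `ket 2`, `ket 3`. -/
theorem row_zero_of_sform_highKet {E : Matrix (Fin 4) (Fin 4) ℂ}
    (h : ∀ t < 3, sform E (ket 0) (highKet t) = 0) : E 0 1 = 0 ∧ E 0 2 = 0 ∧ E 0 3 = 0 := by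
  have h0 := h 0 (by norm_num)
  have h1 := h 1 (by norm_num)
  have h2 := h 2 (by norm_num)
  simp [sform, ket_ofLp, highKet_zero, highKet_one, highKet_two, mulVec, dotProduct,
    Fin.sum_univ_four] at h0 h1 h2
  have hω := omega_sq
  clear h
  generalize ω = w at *
  refine ⟨?_, ?_, ?_⟩ <;> grind

theorem row_three_of_sform_lowKet {E : Matrix (Fin 4) (Fin 4) ℂ}
    (h : ∀ t < 3, sform E (ket 3) (lowKet t) = 0) : E 3 0 = 0 ∧ E 3 1 = 0 ∧ E 3 2 = 0 := by
  have h0 := h 0 (by norm_num)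
  have h1 := h 1 (by norm_num)
  have h2 := h 2 (by norm_num)
  simp [sform, ket_ofLp, lowKet_zero, lowKet_one, lowKet_two, mulVec, dotProduct,
    Fin.sum_univ_four] at h0 h1 h2
  have hω := omega_sq
  clear h
  generalize ω = w at *
  refine ⟨?_, ?_, ?_⟩ <;> grind

/-- The two circulant blocks share the entries with indices 1 and 2, so their constants agree. `E 0
1` and `E 0 2` represent the two off-diagonal classes, and both vanish. Only the corners lie outside
the blocks: `E 0 3` vanishes by `hr`, `E 3 0` by Hermiticity. -/
theorem exists_eq_smul_one_of_row_zero {E : Matrix (Fin 4) (Fin 4) ℂ}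
    (hl : ∀ t < 3, ∀ s < 3, t ≠ s → sform E (lowKet t) (lowKet s) = 0)
    (hh : ∀ t < 3, ∀ s < 3, t ≠ s → sform E (highKet t) (highKet s) = 0)
    (hr : ∀ t < 3, sform E (ket 0) (highKet t) = 0) (hE : E.IsHermitian) :
    ∃ c : ℂ, E = c • 1 := by
  obtain ⟨⟨_, _⟩, ⟨_, _⟩, _, _⟩ := circulant_of_sform_lowKet hl
  obtain ⟨⟨_, _⟩, ⟨_, _⟩, _, _⟩ := circulant_of_sform_highKet hh
  obtain ⟨_, _, h03⟩ := row_zero_of_sform_highKet hr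
  have h30 : E 3 0 = 0 := by simpa [h03] using (hE.apply 3 0).symm
  refine ⟨E 0 0, ?_⟩
  ext i j
  fin_cases i <;> fin_cases j <;> simp <;> grind

theorem exists_eq_smul_one_of_row_three {E : Matrix (Fin 4) (Fin 4) ℂ}
    (hl : ∀ t < 3, ∀ s < 3, t ≠ s → sform E (lowKet t) (lowKet s) = 0)
    (hh : ∀ t < 3, ∀ s < 3, t ≠ s → sform E (highKet t) (highKet s) = 0)
    (hr : ∀ t < 3, sform E (ket 3) (lowKet t) = 0) (hE : E.IsHermitian) :
    ∃ c : ℂ, E = c • 1 := by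
  obtain ⟨⟨_, _⟩, ⟨_, _⟩, _, _⟩ := circulant_of_sform_lowKet hl
  obtain ⟨⟨_, _⟩, ⟨_, _⟩, _, _⟩ := circulant_of_sform_highKet hh
  obtain ⟨h30, _, _⟩ := row_three_of_sform_lowKet hr
  have h03 : E 0 3 = 0 := by simpa [h30] using (hE.apply 0 3).symm
  refine ⟨E 0 0, ?_⟩
  ext i j
  fin_cases i <;> fin_cases j <;> simp <;> grind

/-! ### The twelve states and operators keeping them orthogonal. -/

theorem inner_phi (i j : Fin 12) : inner ℂ (phi i) (phi j) = if i = j then 3 else 0 := by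
  have hω := omega_sq
  fin_cases i <;> fin_cases j <;>
    simp [-inner_self_eq_norm_sq_to_K, phi, inner_prodState, ket_ofLp, lowKet_zero, lowKet_one,
      lowKet_two, highKet_zero, highKet_one, highKet_two, dotProduct, Fin.sum_univ_four,
      conj_omega] <;> grind

theorem phi_eq_prodState (i : Fin 12) : ∃ u v, phi i = prodState u v := by
  fin_cases i <;> exact ⟨_, _, rfl⟩

theorem isOPS_phi : IsOPS phi := by
  refine ⟨fun i => ⟨fun h => ?_, phi_eq_prodState i⟩, fun i j hij => by simp [inner_phi, hij]⟩
  have := inner_phi i i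
  simp [h] at this

theorem phi_ket_low (t : ℕ) (ht : t < 3) :
    phi ⟨t, by lia⟩ = prodState (ket 0) (lowKet t) := by
  interval_cases t <;> rfl

theorem phi_low_ket (t : ℕ) (ht : t < 3) :
    phi ⟨t + 3, by lia⟩ = prodState (lowKet t) (ket 3) := by
  interval_cases t <;> rfl

theorem phi_ket_high (t : ℕ) (ht : t < 3) :
    phi ⟨t + 6, by lia⟩ = prodState (ket 3) (highKet t) := by
  interval_cases t <;> rfl

theorem phi_high_ket (t : ℕ) (ht : t < 3) :
    phi ⟨t + 9, by lia⟩ = prodState (highKet t) (ket 0) := by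
  interval_cases t <;> rfl

theorem sform_smul_one_ne_zero {u v : EuclideanSpace ℂ (Fin 4)} {β : ℂ} (hβ : β ≠ 0)
    (h : star u.ofLp ⬝ᵥ v.ofLp = 1) : sform (β • 1) u v ≠ 0 := by
  simpa [sform, Matrix.smul_mulVec, h] using hβ

/-- If `A ⊗ B` keeps the twelve states orthogonal and `B` is a nonzero multiple of an isometry, then
`A` is a multiple of an isometry. -/
theorem conjTranspose_mul_self_left_eq_smul_one {a b : ℕ} {A : Matrix (Fin a) (Fin 4) ℂ}
    {B : Matrix (Fin b) (Fin 4) ℂ} {β : ℂ} (hβ : β ≠ 0) (hB : Bᴴ * B = β • 1)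
    (h : ∀ i j, i ≠ j → inner ℂ (applyAB A B (phi i)) (applyAB A B (phi j)) = 0) :
    ∃ α : ℂ, Aᴴ * A = α • 1 := by
  refine exists_eq_smul_one_of_row_zero (fun t ht s hs hts => ?_) (fun t ht s hs hts => ?_)
    (fun t ht => ?_) (isHermitian_conjTranspose_mul_self A)
  · have := h ⟨t + 3, by lia⟩ ⟨s + 3, by lia⟩ (by simpa using hts)
    rw [phi_low_ket t ht, phi_low_ket s hs, inner_applyAB_prodState, hB] at this
    exact (mul_eq_zero.1 this).resolve_right (sform_smul_one_ne_zero hβ (by simp [ket_ofLp]))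
  · have := h ⟨t + 9, by lia⟩ ⟨s + 9, by lia⟩ (by simpa using hts)
    rw [phi_high_ket t ht, phi_high_ket s hs, inner_applyAB_prodState, hB] at this
    exact (mul_eq_zero.1 this).resolve_right (sform_smul_one_ne_zero hβ (by simp [ket_ofLp]))
  -- Bob's vectors `lowKet 0` and `ket 0` have overlap 1, so the orthogonality must come from
  -- Alice's side.
  · have := h ⟨0, by lia⟩ ⟨t + 9, by lia⟩ (by simp)
    rw [phi_ket_low 0 (by norm_num), phi_high_ket t ht, inner_applyAB_prodState, hB] at this
    exact (mul_eq_zero.1 this).resolve_right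
      (sform_smul_one_ne_zero hβ (by simp [ket_ofLp, lowKet_zero]))

/-- If `A ⊗ B` keeps the twelve states orthogonal and `A` is a nonzero multiple of an isometry, then
`B` is a multiple of an isometry. -/
theorem conjTranspose_mul_self_right_eq_smul_one {a b : ℕ} {A : Matrix (Fin a) (Fin 4) ℂ}
    {B : Matrix (Fin b) (Fin 4) ℂ} {α : ℂ} (hα : α ≠ 0) (hA : Aᴴ * A = α • 1)
    (h : ∀ i j, i ≠ j → inner ℂ (applyAB A B (phi i)) (applyAB A B (phi j)) = 0) :
    ∃ β : ℂ, Bᴴ * B = β • 1 := by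
  refine exists_eq_smul_one_of_row_three (fun t ht s hs hts => ?_) (fun t ht s hs hts => ?_)
    (fun t ht => ?_) (isHermitian_conjTranspose_mul_self B)
  · have := h ⟨t, by lia⟩ ⟨s, by lia⟩ (by simpa using hts)
    rw [phi_ket_low t ht, phi_ket_low s hs, inner_applyAB_prodState, hA] at this
    exact (mul_eq_zero.1 this).resolve_left (sform_smul_one_ne_zero hα (by simp [ket_ofLp]))
  · have := h ⟨t + 6, by lia⟩ ⟨s + 6, by lia⟩ (by simpa using hts)
    rw [phi_ket_high t ht, phi_ket_high s hs, inner_applyAB_prodState, hA] at this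
    exact (mul_eq_zero.1 this).resolve_left (sform_smul_one_ne_zero hα (by simp [ket_ofLp]))
  -- Here Alice's vectors `lowKet 0` and `ket 0` overlap, which puts the condition on Bob.
  · have := h ⟨0 + 3, by lia⟩ ⟨t, by lia⟩ (Fin.ne_of_val_ne (by simp only; lia))
    rw [phi_low_ket 0 (by norm_num), phi_ket_low t ht, inner_applyAB_prodState, hA] at this
    exact (mul_eq_zero.1 this).resolve_left
      (sform_smul_one_ne_zero hα (by simp [ket_ofLp, lowKet_zero]))

theorem norm_sq_applyAB_of_isometry {a a' b b' : ℕ} {A : Matrix (Fin a') (Fin a) ℂ}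
    {B : Matrix (Fin b') (Fin b) ℂ} {α β : ℂ} (hA : Aᴴ * A = α • 1) (hB : Bᴴ * B = β • 1)
    (ψ : H a b) : ‖applyAB A B ψ‖ ^ 2 = (α * β * inner ℂ ψ ψ).re := by
  rw [norm_sq_applyAB_eq, hA, hB, EuclideanSpace.inner_eq_star_dotProduct, dotProduct_comm]
  simp [Matrix.smul_kronecker, Matrix.kronecker_smul, Matrix.smul_mulVec, mul_assoc, smul_smul]
  ring

/-! ### No information gain along a protocol. -/

namespace Protocol

theorem Extends.refl {ι : Type} {a b : ℕ} (P : Protocol ι a b) : P.Extends P := by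
  induction P with
  | guess i => exact .guess i _
  | alice I next ih => exact .alice I _ _ ih
  | bob I next ih => exact .bob I _ _ ih

theorem Extends.exists_alice {ι : Type} {a b : ℕ} {I : LocalInstrument a}
    {next : (k : Fin I.numOut) → Protocol ι (I.outDim k) b} {Q : Protocol ι a b}
    (h : (Protocol.alice I next).Extends Q) :
    ∃ next', Q = Protocol.alice I next' ∧ ∀ k, (next k).Extends (next' k) := by
  cases h with
  | alice _ _ next' h => exact ⟨next', rfl, h⟩

theorem Extends.exists_bob {ι : Type} {a b : ℕ} {I : LocalInstrument b}
    {next : (k : Fin I.numOut) → Protocol ι a (I.outDim k)} {Q : Protocol ι a b}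
    (h : (Protocol.bob I next).Extends Q) :
    ∃ next', Q = Protocol.bob I next' ∧ ∀ k, (next k).Extends (next' k) := by
  cases h with
  | bob _ _ next' h => exact ⟨next', rfl, h⟩

theorem Extends.trans {ι : Type} {a b : ℕ} {P Q R : Protocol ι a b} (h : P.Extends Q)
    (h' : Q.Extends R) : P.Extends R := by
  induction h with
  | guess i => exact .guess i _
  | alice I next next' _ ih =>
    obtain ⟨next'', rfl, h''⟩ := h'.exists_alice
    exact .alice I _ _ fun k => ih k (h'' k)
  | bob I next next' _ ih =>
    obtain ⟨next'', rfl, h''⟩ := h'.exists_bob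
    exact .bob I _ _ fun k => ih k (h'' k)

/-- A protocol that can be continued to perfect discrimination of the twelve states (or of their
images under local scaled isometries) gains no information on them. -/
theorem weight_eq_of_perfectLimit {a b : ℕ} (Q : Protocol (Fin 12) a b)
    {P : ℕ → Protocol (Fin 12) a b} (hP : ∀ n, Q.Extends (P n))
    {A : Matrix (Fin a) (Fin 4) ℂ} {B : Matrix (Fin b) (Fin 4) ℂ} {α β : ℂ}
    (hA : Aᴴ * A = α • 1) (hB : Bᴴ * B = β • 1)
    (hlim : PerfectLimit P fun i => applyAB A B (phi i)) (i j l : Fin 12) :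
    Q.weight i (applyAB A B (phi j)) = Q.weight i (applyAB A B (phi l)) := by
  induction Q generalizing α β with
  | guess g =>
    simp only [weight, norm_sq_applyAB_of_isometry hA hB, inner_phi, if_true]
  | alice I next ih =>
    -- If `B` vanishes, orthogonality says nothing about `A`, but all weights are zero.
    by_cases hβ : β = 0
    · have : B = 0 := by
        rw [← conjTranspose_mul_self_eq_zero, hB, hβ, zero_smul]
      simp only [this, applyAB_zero_right, weight_zero]
    choose next' hnext hext using fun n => (hP n).exists_alice
    obtain rfl : P = fun n => alice I (next' n) := funext hnext
    simp only [weight]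
    refine Finset.sum_congr rfl fun k _ => Finset.sum_congr rfl fun s _ => ?_
    -- The constraint on this branch comes from the limit of the extensions `P`, while the induction
    -- runs over the finite stage only.
    have hk := hlim.of_alice k s
    simp only [applyA_applyAB] at hk ⊢
    obtain ⟨α', hα'⟩ := conjTranspose_mul_self_left_eq_smul_one hβ hB
      fun i j hij => hk.inner_eq_zero hij
    exact ih k (fun n => hext n k) hα' hB hk
  | bob I next ih =>
    by_cases hα : α = 0
    · have : A = 0 := by
        rw [← conjTranspose_mul_self_eq_zero, hA, hα, zero_smul]
      simp only [this, applyAB_zero_left, weight_zero]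
    choose next' hnext hext using fun n => (hP n).exists_bob
    obtain rfl : P = fun n => bob I (next' n) := funext hnext
    simp only [weight]
    refine Finset.sum_congr rfl fun k _ => Finset.sum_congr rfl fun s _ => ?_
    have hk := hlim.of_bob k s
    simp only [applyB_applyAB] at hk ⊢
    obtain ⟨β', hβ'⟩ := conjTranspose_mul_self_right_eq_smul_one hα hA
      fun i j hij => hk.inner_eq_zero hij
    exact ih k (fun n => hext n k) hA hβ' hk

end Protocol

theorem extends_of_le {ι : Type} {a b : ℕ} {P : ℕ → Protocol ι a b}
    (h : ∀ n, (P n).Extends (P (n + 1))) {m n : ℕ} (hmn : m ≤ n) : (P m).Extends (P n) := by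
  induction hmn with
  | refl => exact .refl _
  | step _ ih => exact ih.trans (h _)

theorem norm_sq_phi (i : Fin 12) : ‖phi i‖ ^ 2 = 3 := by
  rw [← inner_self_eq_norm_sq (𝕜 := ℂ), inner_phi]
  simp

theorem not_loccDistinguishable_phi : ¬ LOCCDistinguishable phi := by
  rintro ⟨P, hext, hP⟩
  have hlim : PerfectLimit P phi := fun i => by
    have := (hP i).mul_const (‖phi i‖ ^ 2)
    simpa [Protocol.prob, norm_sq_phi] using this
  have hweight (n : ℕ) (i : Fin 12) : (P n).weight i (phi 0) = (P n).weight i (phi i) := by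
    -- The tail from stage `n` on consists of extensions of `P n` and has the same limit.
    have hn : PerfectLimit (fun m => P (n + m)) fun i => applyAB 1 1 (phi i) := fun i => by
      simpa only [applyAB_one_one, add_comm] using (tendsto_add_atTop_iff_nat n).2 (hlim i)
    simpa only [applyAB_one_one] using
      (P n).weight_eq_of_perfectLimit (fun m => extends_of_le hext (Nat.le_add_right n m))
        (α := 1) (β := 1) (by simp) (by simp) hn i 0 i
  have h := tendsto_finsetSum (Finset.univ : Finset (Fin 12)) fun i _ => hlim i
  -- The sum equals `‖phi 0‖ ^ 2 = 3` at every stage, against the limit `12 * 3`.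
  simp only [← hweight, Protocol.sum_weight, norm_sq_phi] at h
  have := tendsto_nhds_unique h tendsto_const_nhds
  norm_num at this

end

theorem theorem1 : IsOPS phi ∧ ¬ LOCCDistinguishable phi :=
  ⟨isOPS_phi, not_loccDistinguishable_phi⟩
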